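/- Let $X$ be a (real or complex) Banach space and let $T$ be a bounded linear operator on $X$. Write $\mathcal N(\cdot)$ and $\mathcal R(\cdot)$ for null space and range. A subspace is topologically complemented if it is closed and has a closed algebraic complement; equivalently, it is the range of a bounded projection. A bounded operator $S$ on a normed space $E$ is called left essentially invertible if $\mathcal R(S)$ is closed, $\dim\mathcal N(S)<\infty$ and $\mathcal R(S)$ is the range of a bounded projection of $E$; it is called right essentially invertible if $\dim E/\mathcal R(S)<\infty$ and $\mathcal N(S)$ is the range of a bounded projection of $E$. Let $\operatorname{dis}(T)\in\{0,1,2,\dots\}\cup\{\infty\}$ be the infimum of the set of all integers $n\ge 0$ such that $\mathcal N(T)\cap\mathcal R(T^n)=\mathcal N(T)\cap\mathcal R(T^m)$ for all $m\ge n$ (with $\inf\emptyset=\infty$). The operator $T$ is called left B-Fredholm if $d:=\operatorname{dis}(T)$ is finite, $\mathcal N(T)\cap\mathcal R(T^d)$ is finite-dimensional and $\mathcal R(T)+\mathcal N(T^d)$ is topologically complemented in $X$. It is called right B-Fredholm if $d:=\operatorname{dis}(T)$ is finite, $\mathcal R(T)+\mathcal N(T^d)$ is closed of finite codimension in $X$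 and $\mathcal N(T)\cap\mathcal R(T^d)$ is topologically complemented in $X$. Then: (i) $T$ is left B-Fredholm if and only if there is an integer $d\ge 0$ such that the restriction $T|_{\mathcal R(T^d)}:\mathcal R(T^d)\to\mathcal R(T^d)$ is left essentially invertible, $\mathcal R(T^d)$ is closed in $X$, and $\mathcal N(T^d)$ is topologically complemented in $X$. (ii) $T$ is right B-Fredholm if and only if there is an integer $d\ge 0$ such that the restriction $T|_{\mathcal R(T^d)}:\mathcal R(T^d)\to\mathcal R(T^d)$ is right essentially invertible and $\mathcal R(T^d)$ is topologically complemented in $X$. -/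

import Mathlib

namespace BFredholm

section Semi

variable {𝕜 E : Type*} [RCLike 𝕜] [NormedAddCommGroup E] [NormedSpace 𝕜 E]

/-- `S` is upper semi Fredholm: its range is closed and its null space is finite-dimensional. -/
structure UpperSemiFredholm (S : E →L[𝕜] E) : Prop where
  isClosed_range : IsClosed (S.range : Set E)
  finite_ker : FiniteDimensional 𝕜 S.ker

/-- `S` is lower semi Fredholm: its range has finite codimension. -/
structure LowerSemiFredholm (S : E →L[𝕜] E) : Prop where
  finite_coker : FiniteDimensional 𝕜 (E ⧸ S.range)

/-- `S` is left essentially invertible: it is upper semi Fredholm and its range is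
topologically complemented. -/
structure LeftEssentiallyInvertible (S : E →L[𝕜] E) : Prop where
  upperSemiFredholm : UpperSemiFredholm S
  complemented_range : S.range.ClosedComplemented

/-- `S` is right essentially invertible: it is lower semi Fredholm and its null space is
topologically complemented. -/
structure RightEssentiallyInvertible (S : E →L[𝕜] E) : Prop where
  lowerSemiFredholm : LowerSemiFredholm S
  complemented_ker : S.ker.ClosedComplemented

end Semi

section B

variable {𝕜 X : Type*} [RCLike 𝕜] [NormedAddCommGroup X] [NormedSpace 𝕜 X]

/-- The range of `T ^ n` is invariant under `T`. -/
theorem map_mem_range_pow (T : X →L[𝕜] X) (n : ℕ) (x : X) (hx : x ∈ (T ^ n).range) :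
    T x ∈ (T ^ n).range := by
  obtain ⟨y, rfl⟩ := hx
  refine ⟨T y, ?_⟩
  change (T ^ n * T) y = (T * T ^ n) y
  rw [← pow_succ, ← pow_succ']

/-- The restriction of `T` to the range of `T ^ n`, as an operator on that subspace (with the
norm inherited from `X`). -/
def restrictRangePow (T : X →L[𝕜] X) (n : ℕ) : (T ^ n).range →L[𝕜] (T ^ n).range :=
  T.restrict (map_mem_range_pow T n)

/-- The set of all `n` such that `N(T) ∩ R(T ^ n) = N(T) ∩ R(T ^ m)` for all `m ≥ n`. -/
def stableSet (T : X →L[𝕜] X) : Set ℕ :=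
  {n | ∀ m, n ≤ m → T.ker ⊓ (T ^ n).range = T.ker ⊓ (T ^ m).range}

/-- The degree of stable iteration of `T`: the infimum of `stableSet T`, which is `⊤` when
that set is empty. -/
noncomputable def dis (T : X →L[𝕜] X) : ℕ∞ :=
  sInf ((fun n : ℕ => (n : ℕ∞)) '' stableSet T)

/-- `T` is left B-Fredholm: `d = dis T` is finite, `N(T) ∩ R(T ^ d)` is finite-dimensional and
`R(T) + N(T ^ d)` is topologically complemented. -/
def LeftBFredholm (T : X →L[𝕜] X) : Prop :=
  ∃ d : ℕ, dis T = d ∧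
    FiniteDimensional 𝕜 (T.ker ⊓ (T ^ d).range : Submodule 𝕜 X) ∧
    (T.range ⊔ (T ^ d).ker).ClosedComplemented

/-- `T` is right B-Fredholm: `d = dis T` is finite, `R(T) + N(T ^ d)` is closed of finite
codimension and `N(T) ∩ R(T ^ d)` is topologically complemented. -/
def RightBFredholm (T : X →L[𝕜] X) : Prop :=
  ∃ d : ℕ, dis T = d ∧
    IsClosed ((T.range ⊔ (T ^ d).ker : Submodule 𝕜 X) : Set X) ∧
    FiniteDimensional 𝕜 (X ⧸ (T.range ⊔ (T ^ d).ker)) ∧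
    (T.ker ⊓ (T ^ d).range).ClosedComplemented

end B

end BFredholm

namespace BFredholm

/-! ### Complemented subspaces and operator ranges in Banach spaces -/

section General

variable {𝕜 E F G X : Type*} [RCLike 𝕜]
  [NormedAddCommGroup E] [NormedSpace 𝕜 E] [NormedAddCommGroup F] [NormedSpace 𝕜 F]
  [NormedAddCommGroup G] [NormedSpace 𝕜 G] [NormedAddCommGroup X] [NormedSpace 𝕜 X]

/-! Put `L_n = N(T) ∩ R(T^n)` and `M_n = R(T) + N(T^n)`. The restriction of `T` to `R(T^n)` has null
space `L_n`, and its range pulls back under `T^n` to `M_n`; the chains `L_n` and `M_n` become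
stationary at the same index.

From the degree `d` of stable iteration: `L_d` and `M_d` are both complemented, since
finite-dimensional subspaces and closed subspaces of finite codimension are. Stability lets
projections be built by induction on `k` onto `R(T^k) + N(T^d)` and `N(T^k) ∩ R(T^d)`. At `k = d`,
Neubauer's lemma makes `R(T^d)` closed, and two closed subspaces with complemented sum and
intersection are themselves complemented (`closedComplemented_range_pow_and_ker_pow`).

Conversely, at an arbitrary `d`, finite dimension of `L_d` or finite codimension of `M_d` forces
stabilization. The conditions pass from `d` to every larger index, and stability carries them to the
degree. -/

theorem closedComplemented_iff_exists_projection {A : Submodule 𝕜 X} :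
    A.ClosedComplemented ↔ ∃ P : X →L[𝕜] X, (∀ x, P x ∈ A) ∧ ∀ x ∈ A, P x = x := by
  constructor
  · rintro ⟨f, hf⟩
    exact ⟨A.subtypeL.comp f, fun x => (f x).2, fun x hx => congrArg Subtype.val (hf ⟨x, hx⟩)⟩
  · rintro ⟨P, hP, hPA⟩
    exact ⟨P.codRestrict A hP, fun x => Subtype.ext (hPA x x.2)⟩

/-- A bounded operator factors through any bounded surjection of Banach spaces whose kernel it
annihilates. -/
theorem exists_factor_of_surjective [CompleteSpace E] [CompleteSpace F] (f : E →L[𝕜] F)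
    (hf : Function.Surjective f) (g : E →L[𝕜] G) (hfg : ∀ x, f x = 0 → g x = 0) :
    ∃ h : F →L[𝕜] G, ∀ x, h (f x) = g x := by
  have key : ∀ x y, f x = f y → g x = g y := fun x y hxy => by
    have := hfg (x - y) (by simp [hxy])
    rwa [map_sub, sub_eq_zero] at this
  have hs := Function.surjInv_eq hf
  have hv : ∀ x, g (Function.surjInv hf (f x)) = g x := fun x => key _ _ (hs _)
  let h : F →ₗ[𝕜] G :=
    { toFun := fun y => g (Function.surjInv hf y)
      map_add' := fun y z => by
        rw [← map_add]; exact key _ _ (by simp [hs])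
      map_smul' := fun c y => by
        rw [RingHom.id_apply, ← map_smul]; exact key _ _ (by simp [hs]) }
  refine ⟨⟨h, ?_⟩, hv⟩
  refine (f.isQuotientMap hf).continuous_iff.2 ?_
  convert g.continuous using 1
  exact funext hv

/-- A bounded operator factors through any bounded operator with complemented range whose kernel
it annihilates. -/
theorem exists_factor_of_closedComplemented_range [CompleteSpace E] [CompleteSpace X]
    (f : E →L[𝕜] X) {A : Submodule 𝕜 X} (hA : A.ClosedComplemented) (hfA : ∀ x, f x ∈ A)
    (hAf : ∀ y ∈ A, ∃ x, f x = y) (g : E →L[𝕜] G) (hfg : ∀ x, f x = 0 → g x = 0) :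
    ∃ h : X →L[𝕜] G, ∀ x, h (f x) = g x := by
  have : CompleteSpace A := hA.isClosed.completeSpace_coe
  obtain ⟨h, hh⟩ := exists_factor_of_surjective (f.codRestrict A hfA)
    (fun y => (hAf y y.2).imp fun x hx => Subtype.ext hx) g
    (fun x hx => hfg x (congrArg Subtype.val hx))
  obtain ⟨p, hp⟩ := hA
  refine ⟨h.comp p, fun x => ?_⟩
  rw [← hh x, ContinuousLinearMap.comp_apply]
  exact congrArg h (hp ⟨f x, hfA x⟩)

/-- Neubauer's lemma: an operator range `R(f)` is closed if there is a closed subspace `B` such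
that `R(f) + B` and `R(f) ∩ B` are closed. -/
theorem isClosed_range_of_isClosed_sup_of_isClosed_inf [CompleteSpace E] [CompleteSpace X]
    (f : E →L[𝕜] X) {B : Submodule 𝕜 X} (hB : IsClosed (B : Set X))
    (hsup : IsClosed ((f.range ⊔ B : Submodule 𝕜 X) : Set X))
    (hinf : IsClosed ((f.range ⊓ B : Submodule 𝕜 X) : Set X)) :
    IsClosed (f.range : Set X) := by
  have : CompleteSpace B := hB.completeSpace_coe
  have : CompleteSpace (f.range ⊔ B : Submodule 𝕜 X) := hsup.completeSpace_coe
  have hmem : ∀ x : E × B, f.coprod B.subtypeL x ∈ f.range ⊔ B := fun x =>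
    Submodule.add_mem_sup ⟨x.1, rfl⟩ x.2.2
  let q : E × B →L[𝕜] (f.range ⊔ B : Submodule 𝕜 X) := (f.coprod B.subtypeL).codRestrict _ hmem
  have hq : Function.Surjective q := by
    rintro ⟨y, hy⟩
    obtain ⟨_, ⟨e, rfl⟩, b, hb, rfl⟩ := Submodule.mem_sup.1 hy
    exact ⟨(e, ⟨b, hb⟩), rfl⟩
  have hpre : IsClosed ((fun y : (f.range ⊔ B : Submodule 𝕜 X) => (y : X)) ⁻¹' f.range) := by
    rw [← (q.isQuotientMap hq).isClosed_preimage]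
    -- Since `f e + b` lies in `R(f)` exactly when `b` does, only `R(f) ∩ B` matters; closedness
    -- then descends along the open surjection `q`.
    have : q ⁻¹' ((fun y : (f.range ⊔ B : Submodule 𝕜 X) => (y : X)) ⁻¹' f.range) =
        (fun x : E × B => (x.2 : X)) ⁻¹' (f.range ⊓ B : Submodule 𝕜 X) := by
      ext x
      change f x.1 + (x.2 : X) ∈ f.range ↔ (x.2 : X) ∈ f.range ⊓ B
      rw [Submodule.add_mem_iff_right _ (show f x.1 ∈ f.range from ⟨x.1, rfl⟩), Submodule.mem_inf]
      exact (and_iff_left x.2.2).symm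
    rw [this]
    exact hinf.preimage (by fun_prop)
  have himg := hsup.isClosedEmbedding_subtypeVal.isClosedMap _ hpre
  convert himg
  ext y
  constructor
  · exact fun hy => ⟨⟨y, Submodule.mem_sup_left hy⟩, hy, rfl⟩
  · rintro ⟨z, hz, rfl⟩
    exact hz

/-- An operator range of finite codimension is closed. -/
theorem isClosed_range_of_finiteDimensional_quotient [CompleteSpace E] [CompleteSpace X]
    (f : E →L[𝕜] X) [FiniteDimensional 𝕜 (X ⧸ f.range)] : IsClosed (f.range : Set X) := by
  obtain ⟨B, hB⟩ := Submodule.exists_isCompl f.range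
  have : FiniteDimensional 𝕜 B := (Submodule.quotientEquivOfIsCompl _ _ hB).finiteDimensional
  refine isClosed_range_of_isClosed_sup_of_isClosed_inf f (B := B) B.closed_of_finiteDimensional
    ?_ ?_
  · rw [hB.sup_eq_top]; exact isClosed_univ
  · rw [hB.inf_eq_bot]; exact isClosed_singleton

/-- If `A` and `B` are closed and `A + B`, `A ∩ B` are complemented, then `B` is complemented. -/
theorem closedComplemented_right_of_sup_of_inf [CompleteSpace X] {A B : Submodule 𝕜 X}
    (hA : IsClosed (A : Set X)) (hB : IsClosed (B : Set X))
    (hsup : (A ⊔ B).ClosedComplemented) (hinf : (A ⊓ B).ClosedComplemented) :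
    B.ClosedComplemented := by
  obtain ⟨P, hP, hP'⟩ := closedComplemented_iff_exists_projection.1 hsup
  obtain ⟨Q, hQ, hQ'⟩ := closedComplemented_iff_exists_projection.1 hinf
  -- `A ∩ N(Q)` complements `B` inside `A + B`; the preimage under `P` adds `N(P)`.
  let W : Submodule 𝕜 X := (A ⊓ Q.ker).comap (P : X →ₗ[𝕜] X)
  have hW : IsClosed (W : Set X) :=
    (hA.inter Q.isClosed_ker).preimage P.continuous
  refine Submodule.ClosedComplemented.of_isCompl_isClosed (q := W) ⟨?_, ?_⟩ hB hW
  · rw [Submodule.disjoint_def]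
    intro x hxB hxW
    have hx : P x = x := hP' x (Submodule.mem_sup_right hxB)
    obtain ⟨h1, h2⟩ : P x ∈ A ∧ Q (P x) = 0 := hxW
    rw [hx] at h1 h2
    rw [← hQ' x ⟨h1, hxB⟩, h2]
  · rw [codisjoint_iff, eq_top_iff]
    intro x _
    obtain ⟨a, ha, b, hb, hab⟩ := Submodule.mem_sup.1 (hP x)
    have hPQ : P (Q a) = Q a := hP' _ (Submodule.mem_sup_left (hQ a).1)
    have hPb : P b = b := hP' b (Submodule.mem_sup_right hb)
    have hmem : Q a + b ∈ B := B.add_mem (hQ a).2 hb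
    refine Submodule.mem_sup.2 ⟨Q a + b, hmem, x - (Q a + b), ?_, by abel⟩
    have hval : P (x - (Q a + b)) = a - Q a := by
      rw [map_sub, map_add, hPQ, hPb, ← hab]; abel
    change P (x - (Q a + b)) ∈ A ∧ Q (P (x - (Q a + b))) = 0
    rw [hval]
    exact ⟨A.sub_mem ha (hQ a).1, by rw [map_sub, hQ' _ (hQ a), sub_self]⟩

/-- The sum of a complemented subspace and a finite-dimensional one is complemented. -/
theorem closedComplemented_sup_of_finiteDimensional {A : Submodule 𝕜 X}
    (hA : A.ClosedComplemented) (V : Submodule 𝕜 X) [FiniteDimensional 𝕜 V] :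
    (A ⊔ V).ClosedComplemented := by
  obtain ⟨P, hP, hP'⟩ := closedComplemented_iff_exists_projection.1 hA
  let R : X →L[𝕜] X := ContinuousLinearMap.id 𝕜 X - P
  let V' : Submodule 𝕜 X := V.map (R : X →ₗ[𝕜] X)
  obtain ⟨Q, hQ, hQ'⟩ := closedComplemented_iff_exists_projection.1
    (Submodule.ClosedComplemented.of_finiteDimensional (𝕜 := 𝕜) V')
  have hV' : ∀ v ∈ V, v - P v ∈ V' := fun v hv => ⟨v, hv, rfl⟩
  refine closedComplemented_iff_exists_projection.2 ⟨P + Q.comp R, fun x => ?_, fun x hx => ?_⟩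
  · obtain ⟨v, hv, hvx⟩ := hQ (R x)
    change P x + Q (R x) ∈ _
    rw [← hvx]
    have : P x + (v - P v) = (P x - P v) + v := by abel
    change P x + (v - P v) ∈ _
    rw [this]
    exact Submodule.add_mem_sup (A.sub_mem (hP _) (hP _)) hv
  · obtain ⟨a, ha, v, hv, rfl⟩ := Submodule.mem_sup.1 hx
    change P (a + v) + Q ((a + v) - P (a + v)) = a + v
    have : (a + v) - P (a + v) = v - P v := by rw [map_add, hP' a ha]; abel
    rw [this, hQ' _ (hV' v hv), map_add, hP' a ha]
    abel

/-- A complemented subspace of a complemented subspace is complemented. -/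
theorem closedComplemented_of_comap_subtype {A C : Submodule 𝕜 X} (hCA : C ≤ A)
    (hC : (C.comap A.subtype).ClosedComplemented) (hA : A.ClosedComplemented) :
    C.ClosedComplemented := by
  obtain ⟨P, hP⟩ := hA
  obtain ⟨Q, hQ, hQ'⟩ := closedComplemented_iff_exists_projection.1 hC
  refine closedComplemented_iff_exists_projection.2
    ⟨(A.subtypeL.comp Q).comp P, fun x => hQ (P x), fun x hx => ?_⟩
  change ((Q (P x) : A) : X) = x
  rw [hP ⟨x, hCA hx⟩, hQ' ⟨x, hCA hx⟩ hx]

theorem closedComplemented_comap_subtype {A C : Submodule 𝕜 X} (hCA : C ≤ A)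
    (hC : C.ClosedComplemented) : (C.comap A.subtype).ClosedComplemented := by
  obtain ⟨P, hP, hP'⟩ := closedComplemented_iff_exists_projection.1 hC
  exact closedComplemented_iff_exists_projection.2
    ⟨(P.comp A.subtypeL).codRestrict A fun x => hCA (hP x), fun x => hP x,
      fun x hx => Subtype.ext (hP' x hx)⟩

end General

/-! ### Ranges and null spaces of powers, and stability -/

section Iterates

variable {𝕜 X : Type*} [RCLike 𝕜] [NormedAddCommGroup X] [NormedSpace 𝕜 X]

theorem pow_add_apply (T : X →L[𝕜] X) (a b : ℕ) (x : X) :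
    (T ^ (a + b)) x = (T ^ a) ((T ^ b) x) := by
  rw [pow_add]; rfl

theorem pow_succ_apply (T : X →L[𝕜] X) (a : ℕ) (x : X) :
    (T ^ (a + 1)) x = (T ^ a) (T x) := by
  rw [pow_succ]; rfl

theorem pow_succ_apply' (T : X →L[𝕜] X) (a : ℕ) (x : X) :
    (T ^ (a + 1)) x = T ((T ^ a) x) := by
  rw [pow_succ']; rfl

theorem range_pow_le (T : X →L[𝕜] X) {m n : ℕ} (h : m ≤ n) : (T ^ n).range ≤ (T ^ m).range := by
  obtain ⟨k, rfl⟩ := Nat.exists_eq_add_of_le h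
  rintro _ ⟨x, rfl⟩
  exact ⟨(T ^ k) x, (pow_add_apply T m k x).symm⟩

theorem ker_pow_le (T : X →L[𝕜] X) {m n : ℕ} (h : m ≤ n) : (T ^ m).ker ≤ (T ^ n).ker := by
  obtain ⟨k, rfl⟩ := Nat.exists_eq_add_of_le' h
  intro x hx
  change (T ^ (k + m)) x = 0
  rw [pow_add_apply, show (T ^ m) x = 0 from hx, map_zero]

/-- `T ^ n` maps `R(T) + N(T ^ n)` onto `R(T ^ (n + 1))`. -/
theorem mem_range_sup_ker_pow_iff (T : X →L[𝕜] X) (n : ℕ) (x : X) :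
    x ∈ T.range ⊔ (T ^ n).ker ↔ (T ^ n) x ∈ (T ^ (n + 1)).range := by
  constructor
  · intro hx
    obtain ⟨_, ⟨y, rfl⟩, u, hu, rfl⟩ := Submodule.mem_sup.1 hx
    refine ⟨y, ?_⟩
    change (T ^ (n + 1)) y = (T ^ n) (T y + u)
    rw [map_add, show (T ^ n) u = 0 from hu, add_zero, pow_succ_apply]
  · rintro ⟨y, hy⟩
    have hy : (T ^ (n + 1)) y = (T ^ n) x := hy
    refine Submodule.mem_sup.2 ⟨T y, ⟨y, rfl⟩, x - T y, ?_, by abel⟩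
    change (T ^ n) (x - T y) = 0
    rw [map_sub, ← hy, pow_succ_apply, sub_self]

/-- `T^n` maps `N(T^(n+1))` onto `N(T) ∩ R(T^n)`. -/
theorem inf_range_pow_le_iff (T : X →L[𝕜] X) (n : ℕ) :
    T.ker ⊓ (T ^ n).range ≤ T.ker ⊓ (T ^ (n + 1)).range ↔
      T.range ⊔ (T ^ (n + 1)).ker ≤ T.range ⊔ (T ^ n).ker := by
  constructor
  · refine fun h => sup_le le_sup_left fun x hx => ?_
    have hx : (T ^ (n + 1)) x = 0 := hx
    rw [pow_succ_apply'] at hx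
    exact (mem_range_sup_ker_pow_iff T n x).2 (h ⟨hx, ⟨x, rfl⟩⟩).2
  · rintro h _ ⟨hy, x, rfl⟩
    refine ⟨hy, (mem_range_sup_ker_pow_iff T n x).1 (h (Submodule.mem_sup_right ?_))⟩
    change (T ^ (n + 1)) x = 0
    rw [pow_succ_apply']
    exact hy

theorem mem_stableSet_of_le {T : X →L[𝕜] X} {d n : ℕ} (hd : d ∈ stableSet T) (h : d ≤ n) :
    n ∈ stableSet T :=
  fun m hm => (hd n h).symm.trans (hd m (h.trans hm))

theorem mem_stableSet_iff_sup (T : X →L[𝕜] X) (d : ℕ) :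
    d ∈ stableSet T ↔ ∀ n, d ≤ n → T.range ⊔ (T ^ d).ker = T.range ⊔ (T ^ n).ker := by
  constructor
  · intro hd n hn
    induction n, hn using Nat.le_induction with
    | base => rfl
    | succ n hn ih =>
      exact ih.trans (le_antisymm (sup_le_sup_left (ker_pow_le T n.le_succ) _)
        ((inf_range_pow_le_iff T n).1 (mem_stableSet_of_le hd hn _ n.le_succ).le))
  · intro hd n hn
    induction n, hn using Nat.le_induction with
    | base => rfl
    | succ n hn ih =>
      exact ih.trans (le_antisymm ((inf_range_pow_le_iff T n).2
        ((hd _ (hn.trans n.le_succ)).symm.trans (hd n hn)).le)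
        (inf_le_inf_left _ (range_pow_le T n.le_succ)))

theorem mem_stableSet_of_dis_eq {T : X →L[𝕜] X} {d : ℕ} (hd : dis T = d) : d ∈ stableSet T := by
  have hne : ((fun n : ℕ => (n : ℕ∞)) '' stableSet T).Nonempty := by
    by_contra h
    rw [Set.not_nonempty_iff_eq_empty] at h
    rw [dis, h, sInf_empty] at hd
    exact ENat.top_ne_natCast d hd
  obtain ⟨n, hn, hnd⟩ := csInf_mem hne
  have : (n : ℕ∞) = d := hnd.trans hd
  rwa [← Nat.cast_inj.1 this]

theorem exists_dis_eq {T : X →L[𝕜] X} (h : (stableSet T).Nonempty) :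
    ∃ d : ℕ, dis T = d ∧ d ∈ stableSet T := by
  obtain ⟨n, hn, hnd⟩ := csInf_mem (h.image (fun n : ℕ => (n : ℕ∞)))
  exact ⟨n, hnd.symm, hn⟩

theorem ker_pow_succ_le_of_mem_stableSet {T : X →L[𝕜] X} {d : ℕ} (hd : d ∈ stableSet T) (k : ℕ) :
    (T ^ (d + 1)).ker ≤ (T ^ k).range ⊔ (T ^ d).ker := by
  intro x hx
  have hx : (T ^ (d + 1)) x = 0 := hx
  have hmem : (T ^ d) x ∈ T.ker ⊓ (T ^ d).range :=
    ⟨(pow_succ_apply' T d x).symm.trans hx, ⟨x, rfl⟩⟩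
  rw [hd (d + k) (Nat.le_add_right _ _)] at hmem
  obtain ⟨-, y, hy⟩ := hmem
  have hy : (T ^ (d + k)) y = (T ^ d) x := hy
  refine Submodule.mem_sup.2 ⟨(T ^ k) y, ⟨y, rfl⟩, x - (T ^ k) y, ?_, by abel⟩
  change (T ^ d) (x - (T ^ k) y) = 0
  rw [map_sub, ← pow_add_apply, hy, sub_self]

/-- By stability, subtracting a suitable element of `R(T^(d+1))` lowers the power of `T` that
annihilates `x`. -/
theorem ker_pow_inf_range_le_of_mem_stableSet {T : X →L[𝕜] X} {d : ℕ} (hd : d ∈ stableSet T)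
    (k : ℕ) : (T ^ k).ker ⊓ (T ^ d).range ≤ (T ^ (d + 1)).range := by
  induction k with
  | zero =>
    rintro x ⟨hx, -⟩
    rw [show x = 0 from hx]
    exact Submodule.zero_mem _
  | succ k ih =>
    rintro x ⟨hx, z, rfl⟩
    have hx : (T ^ (k + 1)) ((T ^ d) z) = 0 := hx
    have hmem : (T ^ k) ((T ^ d) z) ∈ T.ker ⊓ (T ^ (d + k)).range :=
      ⟨(pow_succ_apply' T k _).symm.trans hx, z, by
        change (T ^ (d + k)) z = _
        rw [add_comm, pow_add_apply]⟩
    rw [mem_stableSet_of_le hd (Nat.le_add_right d k) _ (Nat.le_succ _)] at hmem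
    obtain ⟨-, w, hw⟩ := hmem
    have hw : (T ^ (d + k + 1)) w = (T ^ k) ((T ^ d) z) := hw
    have hsub : (T ^ d) z - (T ^ (d + 1)) w ∈ (T ^ k).ker ⊓ (T ^ d).range := by
      refine ⟨?_, Submodule.sub_mem _ ⟨z, rfl⟩ (range_pow_le T d.le_succ ⟨w, rfl⟩)⟩
      change (T ^ k) ((T ^ d) z - (T ^ (d + 1)) w) = 0
      rw [map_sub, ← pow_add_apply T k (d + 1), show k + (d + 1) = d + k + 1 by ring, hw, sub_self]
    have := Submodule.add_mem _ (ih hsub) (show (T ^ (d + 1)) w ∈ (T ^ (d + 1)).range from ⟨w, rfl⟩)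
    rwa [sub_add_cancel] at this

end Iterates

/-! ### Inductive construction of projections -/

section Complements

variable {𝕜 X : Type*} [RCLike 𝕜] [NormedAddCommGroup X] [NormedSpace 𝕜 X] [CompleteSpace X]

/-- The next projection is `T x + u ↦ T (P x) + u` on `M_d`, after projecting onto `M_d`. It is well
defined: `T x + u = 0` puts `x` in `N(T^(d+1))`, which stability places where `P` is the identity.
-/
theorem closedComplemented_range_pow_sup_ker {T : X →L[𝕜] X} {d : ℕ} (hd : d ∈ stableSet T)
    (hM : (T.range ⊔ (T ^ d).ker).ClosedComplemented) (k : ℕ) :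
    ((T ^ k).range ⊔ (T ^ d).ker).ClosedComplemented := by
  induction k with
  | zero =>
    have : (T ^ 0).range ⊔ (T ^ d).ker = ⊤ :=
      eq_top_iff.2 fun x _ => Submodule.mem_sup_left ⟨x, rfl⟩
    rw [this]
    exact Submodule.closedComplemented_top
  | succ k ih =>
    obtain ⟨P, hP, hP'⟩ := closedComplemented_iff_exists_projection.1 ih
    obtain ⟨P₁, hP₁, hP₁'⟩ := closedComplemented_iff_exists_projection.1 hM
    have : CompleteSpace (T ^ d).ker := (T ^ d).isClosed_ker.completeSpace_coe
    obtain ⟨Q, hQ⟩ := exists_factor_of_closedComplemented_range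
      (T.coprod (T ^ d).ker.subtypeL) hM
      (fun x => Submodule.add_mem_sup ⟨x.1, rfl⟩ x.2.2)
      (fun y hy => by
        obtain ⟨_, ⟨x, rfl⟩, u, hu, rfl⟩ := Submodule.mem_sup.1 hy
        exact ⟨(x, ⟨u, hu⟩), rfl⟩)
      ((T.comp P).coprod (T ^ d).ker.subtypeL)
      (fun x hx => by
        have hx : T x.1 + (x.2 : X) = 0 := hx
        have hker : x.1 ∈ (T ^ (d + 1)).ker := by
          change (T ^ (d + 1)) x.1 = 0
          rw [pow_succ_apply, eq_neg_of_add_eq_zero_left hx, map_neg,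
            show (T ^ d) (x.2 : X) = 0 from x.2.2, neg_zero]
        change T (P x.1) + (x.2 : X) = 0
        rwa [hP' _ (ker_pow_succ_le_of_mem_stableSet hd k hker)])
    have hQ : ∀ x, ∀ u ∈ (T ^ d).ker, Q (T x + u) = T (P x) + u := fun x u hu => hQ (x, ⟨u, hu⟩)
    refine closedComplemented_iff_exists_projection.2 ⟨Q.comp P₁, fun x => ?_, fun x hx => ?_⟩
    · obtain ⟨_, ⟨y, rfl⟩, u, hu, hyu⟩ := Submodule.mem_sup.1 (hP₁ x)
      have hyu : T y + u = P₁ x := hyu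
      change Q (P₁ x) ∈ _
      rw [← hyu, hQ y u hu]
      obtain ⟨_, ⟨z, rfl⟩, v, hv, hzv⟩ := Submodule.mem_sup.1 (hP y)
      have hzv : (T ^ k) z + v = P y := hzv
      rw [← hzv, map_add, add_assoc, ← pow_succ_apply']
      refine Submodule.add_mem_sup ⟨z, rfl⟩ (Submodule.add_mem _ ?_ hu)
      change (T ^ d) (T v) = 0
      rw [← pow_succ_apply, pow_succ_apply', show (T ^ d) v = 0 from hv, map_zero]
    · obtain ⟨_, ⟨z, rfl⟩, u, hu, rfl⟩ := Submodule.mem_sup.1 hx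
      have hz : (T ^ (k + 1)) z = T ((T ^ k) z) := pow_succ_apply' T k z
      change Q (P₁ ((T ^ (k + 1)) z + u)) = (T ^ (k + 1)) z + u
      rw [hz, hP₁' (T ((T ^ k) z) + u) (Submodule.add_mem_sup ⟨_, rfl⟩ hu), hQ _ u hu,
        hP' ((T ^ k) z) (Submodule.mem_sup_left ⟨z, rfl⟩)]

/-- `T^(d+1) x ↦ (1 - P₁) (T^d x)` gives a bounded right inverse `s` of `T` on `N(T^k) ∩ R(T^d)`,
which lifts the projection one step. -/
theorem closedComplemented_ker_pow_inf_range {T : X →L[𝕜] X} {d : ℕ} (hd : d ∈ stableSet T)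
    (hL : (T.ker ⊓ (T ^ d).range).ClosedComplemented) (k : ℕ) :
    ((T ^ k).ker ⊓ (T ^ d).range).ClosedComplemented := by
  induction k with
  | zero =>
    have : (T ^ 0).ker ⊓ (T ^ d).range = ⊥ := eq_bot_iff.2 fun x hx => hx.1
    rw [this]
    exact Submodule.closedComplemented_bot
  | succ k ih =>
    obtain ⟨P, hP, hP'⟩ := closedComplemented_iff_exists_projection.1 ih
    obtain ⟨P₁, hP₁, hP₁'⟩ := closedComplemented_iff_exists_projection.1 hL
    -- `R(T^d)` is not yet known to be closed, so `s` is obtained from this complete space, which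
    -- `T^(d+1)` maps onto `N(T^k) ∩ R(T^d)`.
    let N : Submodule 𝕜 X := (T ^ (k + (d + 1))).ker
    have : CompleteSpace N := (T ^ (k + (d + 1))).isClosed_ker.completeSpace_coe
    obtain ⟨s, hs⟩ := exists_factor_of_closedComplemented_range
      ((T ^ (d + 1)).comp N.subtypeL) ih
      (fun x => ⟨(pow_add_apply T k (d + 1) x).symm.trans x.2,
        range_pow_le T d.le_succ ⟨(x : X), rfl⟩⟩)
      (fun y hy => by
        obtain ⟨x, rfl⟩ := ker_pow_inf_range_le_of_mem_stableSet hd k hy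
        exact ⟨⟨x, (pow_add_apply T k (d + 1) x).trans hy.1⟩, rfl⟩)
      (((ContinuousLinearMap.id 𝕜 X - P₁).comp (T ^ d)).comp N.subtypeL)
      (fun x hx => by
        have hx : (T ^ (d + 1)) (x : X) = 0 := hx
        rw [pow_succ_apply'] at hx
        change (T ^ d) (x : X) - P₁ ((T ^ d) (x : X)) = 0
        rw [hP₁' _ ⟨hx, ⟨(x : X), rfl⟩⟩, sub_self])
    have hTs : ∀ y ∈ (T ^ k).ker ⊓ (T ^ d).range, T (s y) = y ∧ s y ∈ (T ^ d).range := by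
      intro y hy
      obtain ⟨x, rfl⟩ := ker_pow_inf_range_le_of_mem_stableSet hd k hy
      have hsx : s ((T ^ (d + 1)) x) = (T ^ d) x - P₁ ((T ^ d) x) :=
        hs ⟨x, (pow_add_apply T k (d + 1) x).trans hy.1⟩
      change T (s ((T ^ (d + 1)) x)) = (T ^ (d + 1)) x ∧ s ((T ^ (d + 1)) x) ∈ _
      rw [hsx]
      refine ⟨?_, Submodule.sub_mem _ ⟨x, rfl⟩ (hP₁ _).2⟩
      rw [map_sub, show T (P₁ ((T ^ d) x)) = 0 from (hP₁ _).1, sub_zero, pow_succ_apply']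
    refine closedComplemented_iff_exists_projection.2
      ⟨P₁.comp (ContinuousLinearMap.id 𝕜 X - (s.comp P).comp T) + (s.comp P).comp T,
        fun x => ?_, fun x hx => ?_⟩
    · change P₁ (x - s (P (T x))) + s (P (T x)) ∈ _
      refine ⟨?_, Submodule.add_mem _ (hP₁ _).2 (hTs _ (hP _)).2⟩
      change (T ^ (k + 1)) _ = 0
      rw [pow_succ_apply, map_add, show T (P₁ _) = 0 from (hP₁ _).1, (hTs _ (hP _)).1, zero_add]
      exact (hP _).1
    · have hTx : T x ∈ (T ^ k).ker ⊓ (T ^ d).range :=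
        ⟨(pow_succ_apply T k x).symm.trans hx.1, map_mem_range_pow T d x hx.2⟩
      obtain ⟨h1, h2⟩ := hTs _ hTx
      change P₁ (x - s (P (T x))) + s (P (T x)) = x
      rw [hP' _ hTx, hP₁' _ ⟨?_, Submodule.sub_mem _ hx.2 h2⟩, sub_add_cancel]
      change T (x - s (T x)) = 0
      rw [map_sub, h1, sub_self]

/-- If `R(T) + N(T ^ d)` and `N(T) ∩ R(T ^ d)` are complemented for a `d` in the stable set, then
`R(T ^ d)` and `N(T ^ d)` are complemented. -/
theorem closedComplemented_range_pow_and_ker_pow {T : X →L[𝕜] X} {d : ℕ} (hd : d ∈ stableSet T)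
    (hM : (T.range ⊔ (T ^ d).ker).ClosedComplemented)
    (hL : (T.ker ⊓ (T ^ d).range).ClosedComplemented) :
    (T ^ d).range.ClosedComplemented ∧ (T ^ d).ker.ClosedComplemented := by
  have hsup := closedComplemented_range_pow_sup_ker hd hM d
  have hinf := closedComplemented_ker_pow_inf_range hd hL d
  have hN := (T ^ d).isClosed_ker
  have hR : IsClosed ((T ^ d).range : Set X) :=
    isClosed_range_of_isClosed_sup_of_isClosed_inf _ hN hsup.isClosed
      (by rw [inf_comm]; exact hinf.isClosed)
  exact ⟨closedComplemented_right_of_sup_of_inf hN hR (by rwa [sup_comm]) hinf,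
    closedComplemented_right_of_sup_of_inf hR hN hsup (by rwa [inf_comm])⟩

end Complements

/-! ### Finite dimension and codimension -/

section LinearAlgebra

variable {𝕜 V W : Type*} [Field 𝕜] [AddCommGroup V] [Module 𝕜 V] [AddCommGroup W] [Module 𝕜 W]

theorem finiteDimensional_quotient_comap (f : V →ₗ[𝕜] W) (q : Submodule 𝕜 W)
    [FiniteDimensional 𝕜 (W ⧸ q)] : FiniteDimensional 𝕜 (V ⧸ q.comap f) := by
  have h : q.comap f = (q.mkQ.comp f).ker := by rw [LinearMap.ker_comp, Submodule.ker_mkQ]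
  rw [h]
  exact (q.mkQ.comp f).quotKerEquivRange.symm.finiteDimensional

theorem finiteDimensional_quotient_of_comap {f : V →ₗ[𝕜] W} (hf : Function.Surjective f)
    (q : Submodule 𝕜 W) [FiniteDimensional 𝕜 (V ⧸ q.comap f)] : FiniteDimensional 𝕜 (W ⧸ q) := by
  refine Module.Finite.of_surjective (Submodule.mapQ (q.comap f) q f le_rfl) fun y => ?_
  obtain ⟨w, rfl⟩ := q.mkQ_surjective y
  obtain ⟨v, rfl⟩ := hf w
  exact ⟨(q.comap f).mkQ v, rfl⟩

theorem finiteDimensional_quotient_of_sup_eq_top {p q : Submodule 𝕜 V} [FiniteDimensional 𝕜 q]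
    (h : p ⊔ q = ⊤) : FiniteDimensional 𝕜 (V ⧸ p) := by
  refine Module.Finite.of_surjective (p.mkQ.comp q.subtype) fun y => ?_
  obtain ⟨v, rfl⟩ := p.mkQ_surjective y
  obtain ⟨a, ha, b, hb, rfl⟩ := Submodule.mem_sup.1 (h ▸ Submodule.mem_top : v ∈ p ⊔ q)
  refine ⟨⟨b, hb⟩, ?_⟩
  change p.mkQ b = p.mkQ (a + b)
  rw [map_add, show p.mkQ a = 0 from (Submodule.Quotient.mk_eq_zero p).2 ha, zero_add]

theorem finiteDimensional_quotient_range_pow (f : V →ₗ[𝕜] V) [FiniteDimensional 𝕜 (V ⧸ f.range)]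
    (k : ℕ) : FiniteDimensional 𝕜 (V ⧸ (f ^ k).range) := by
  induction k with
  | zero =>
    refine finiteDimensional_quotient_of_sup_eq_top (q := ⊥) (eq_top_iff.2 fun x _ => ?_)
    exact Submodule.mem_sup_left ⟨x, rfl⟩
  | succ k ih =>
    obtain ⟨A, hA⟩ := Submodule.exists_isCompl f.range
    obtain ⟨B, hB⟩ := Submodule.exists_isCompl (f ^ k).range
    have : FiniteDimensional 𝕜 A := (Submodule.quotientEquivOfIsCompl _ _ hA).finiteDimensional
    have : FiniteDimensional 𝕜 B := (Submodule.quotientEquivOfIsCompl _ _ hB).finiteDimensional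
    refine finiteDimensional_quotient_of_sup_eq_top (q := B.map f ⊔ A) ?_
    -- Apply `f` to `V = R(f^k) + B`.
    have h : f.range = (f ^ (k + 1)).range ⊔ B.map f := by
      rw [pow_succ', Module.End.mul_eq_comp, LinearMap.range_comp, ← Submodule.map_sup,
        hB.sup_eq_top, Submodule.map_top]
    rw [← sup_assoc, ← h, hA.sup_eq_top]

/-- A subspace with finite-dimensional image is spanned by its intersection with the null space
and a finite-dimensional subspace. -/
theorem exists_finiteDimensional_le_ker_sup (f : V →ₗ[𝕜] W) (K : Submodule 𝕜 V)
    [FiniteDimensional 𝕜 (K.map f)] :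
    ∃ U : Submodule 𝕜 V, FiniteDimensional 𝕜 U ∧ U ≤ K ∧ K ≤ f.ker ⊔ U := by
  let g : K →ₗ[𝕜] K.map f := f.submoduleMap K
  obtain ⟨s, hs⟩ := g.exists_rightInverse_of_surjective
    (LinearMap.range_eq_top.2 (f.submoduleMap_surjective K))
  refine ⟨(K.subtype.comp s).range, inferInstance, ?_, fun x hx => ?_⟩
  · rintro _ ⟨y, rfl⟩
    exact (s y).2
  · refine Submodule.mem_sup.2 ⟨x - s (g ⟨x, hx⟩), ?_, s (g ⟨x, hx⟩), ⟨_, rfl⟩, by abel⟩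
    rw [LinearMap.mem_ker, map_sub, sub_eq_zero]
    exact (congrArg Subtype.val (LinearMap.congr_fun hs (g ⟨x, hx⟩))).symm

end LinearAlgebra

/-! ### The restriction of `T` to `R(T^d)` -/

section Restriction

variable {𝕜 X : Type*} [RCLike 𝕜] [NormedAddCommGroup X] [NormedSpace 𝕜 X]

theorem ker_restrictRangePow (T : X →L[𝕜] X) (d : ℕ) :
    (restrictRangePow T d).ker = (T.ker ⊓ (T ^ d).range).comap (T ^ d).range.subtype := by
  ext x
  exact ⟨fun hx => ⟨congrArg Subtype.val hx, x.2⟩, fun hx => Subtype.ext hx.1⟩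

theorem range_restrictRangePow_pow (T : X →L[𝕜] X) (d k : ℕ) :
    (restrictRangePow T d ^ k).range = (T ^ (d + k)).range.comap (T ^ d).range.subtype := by
  have hval : ∀ x, (((restrictRangePow T d ^ k) x : (T ^ d).range) : X) = (T ^ k) (x : X) := by
    induction k with
    | zero => exact fun x => rfl
    | succ k ih =>
      intro x
      rw [pow_succ_apply', pow_succ_apply', ← ih]
      rfl
  ext y
  constructor
  · rintro ⟨⟨_, z, rfl⟩, rfl⟩
    refine ⟨z, ?_⟩
    change (T ^ (d + k)) z = (((restrictRangePow T d ^ k) _ : (T ^ d).range) : X)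
    rw [hval, add_comm, pow_add_apply]
    rfl
  · rintro ⟨z, hz⟩
    refine ⟨⟨(T ^ d) z, z, rfl⟩, Subtype.ext ((hval _).trans ?_)⟩
    rw [← pow_add_apply, add_comm]
    exact hz

theorem range_restrictRangePow (T : X →L[𝕜] X) (d : ℕ) :
    (restrictRangePow T d).range = (T ^ (d + 1)).range.comap (T ^ d).range.subtype := by
  rw [← range_restrictRangePow_pow, pow_one]

theorem comap_range_restrictRangePow (T : X →L[𝕜] X) (d : ℕ) :
    (restrictRangePow T d).range.comap (LinearMap.rangeRestrict (T ^ d : X →L[𝕜] X).toLinearMap) =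
      T.range ⊔ (T ^ d).ker := by
  rw [range_restrictRangePow]
  ext x
  exact (mem_range_sup_ker_pow_iff T d x).symm

theorem finiteDimensional_quotient_range_sup_ker_iff (T : X →L[𝕜] X) (d : ℕ) :
    FiniteDimensional 𝕜 (X ⧸ (T.range ⊔ (T ^ d).ker)) ↔
      FiniteDimensional 𝕜 ((T ^ d).range ⧸ (restrictRangePow T d).range) := by
  rw [← comap_range_restrictRangePow]
  exact ⟨fun _ => finiteDimensional_quotient_of_comap (LinearMap.surjective_rangeRestrict _) _,
    fun _ => finiteDimensional_quotient_comap _ _⟩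

theorem finiteDimensional_ker_restrictRangePow_iff (T : X →L[𝕜] X) (d : ℕ) :
    FiniteDimensional 𝕜 (restrictRangePow T d).ker ↔
      FiniteDimensional 𝕜 (T.ker ⊓ (T ^ d).range : Submodule 𝕜 X) := by
  rw [ker_restrictRangePow]
  have e := Submodule.comapSubtypeEquivOfLe
    (inf_le_right : T.ker ⊓ (T ^ d).range ≤ (T ^ d).range)
  exact ⟨fun _ => e.finiteDimensional, fun _ => e.symm.finiteDimensional⟩

variable [CompleteSpace X]

/-- A projection onto `M_d` fixes `N(T^d)`, so it descends through `T^d : X → R(T^d)`. -/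
theorem closedComplemented_range_restrictRangePow {T : X →L[𝕜] X} {d : ℕ}
    (hR : IsClosed ((T ^ d).range : Set X)) (hM : (T.range ⊔ (T ^ d).ker).ClosedComplemented) :
    (restrictRangePow T d).range.ClosedComplemented := by
  have : CompleteSpace (T ^ d).range := hR.completeSpace_coe
  obtain ⟨P, hP, hP'⟩ := closedComplemented_iff_exists_projection.1 hM
  let q : X →L[𝕜] (T ^ d).range := (T ^ d).codRestrict _ fun x => ⟨x, rfl⟩
  have hq : Function.Surjective q := by
    rintro ⟨_, x, rfl⟩
    exact ⟨x, rfl⟩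
  have hmem : ∀ x, q x ∈ (restrictRangePow T d).range ↔ x ∈ T.range ⊔ (T ^ d).ker := fun x => by
    rw [mem_range_sup_ker_pow_iff, range_restrictRangePow]; rfl
  obtain ⟨h, hh⟩ := exists_factor_of_surjective q hq (q.comp P) fun x hx => by
    change q (P x) = 0
    rwa [hP' x (Submodule.mem_sup_right (congrArg Subtype.val hx))]
  refine closedComplemented_iff_exists_projection.2 ⟨h, fun y => ?_, fun y hy => ?_⟩
  · obtain ⟨x, rfl⟩ := hq y
    rw [hh]
    exact (hmem _).2 (hP x)
  · obtain ⟨x, rfl⟩ := hq y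
    rw [hh, ContinuousLinearMap.comp_apply, hP' x ((hmem x).1 hy)]

theorem closedComplemented_range_sup_ker_of_restrictRangePow {T : X →L[𝕜] X} {d : ℕ}
    (hR : IsClosed ((T ^ d).range : Set X)) (hN : (T ^ d).ker.ClosedComplemented)
    (hS : (restrictRangePow T d).range.ClosedComplemented) :
    (T.range ⊔ (T ^ d).ker).ClosedComplemented := by
  have : CompleteSpace (T ^ d).range := hR.completeSpace_coe
  obtain ⟨P, hP, hP'⟩ := closedComplemented_iff_exists_projection.1 hN
  obtain ⟨Q, hQ, hQ'⟩ := closedComplemented_iff_exists_projection.1 hS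
  let q : X →L[𝕜] (T ^ d).range := (T ^ d).codRestrict _ fun x => ⟨x, rfl⟩
  have hq : Function.Surjective q := by
    rintro ⟨_, x, rfl⟩
    exact ⟨x, rfl⟩
  have hmem : ∀ x, x ∈ T.range ⊔ (T ^ d).ker ↔ q x ∈ (restrictRangePow T d).range := fun x => by
    rw [mem_range_sup_ker_pow_iff, range_restrictRangePow]; rfl
  -- Complementing `N(T^d)` yields a bounded section `j` of `q`, along which `Q` lifts.
  obtain ⟨j, hj⟩ := exists_factor_of_surjective q hq (ContinuousLinearMap.id 𝕜 X - P)
    fun x hx => by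
      change x - P x = 0
      rw [hP' x (congrArg Subtype.val hx), sub_self]
  have hqj : ∀ y, q (j y) = y := fun y => by
    obtain ⟨x, rfl⟩ := hq y
    have hPx : q (P x) = 0 := Subtype.ext (hP x)
    rw [hj]
    change q (x - P x) = q x
    rw [map_sub, hPx, sub_zero]
  refine closedComplemented_iff_exists_projection.2
    ⟨ContinuousLinearMap.id 𝕜 X - j.comp q + (j.comp Q).comp q, fun x => ?_, fun x hx => ?_⟩
  · rw [hmem]
    change q (x - j (q x) + j (Q (q x))) ∈ _
    rw [map_add, map_sub, hqj, hqj, sub_self, zero_add]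
    exact hQ _
  · change x - j (q x) + j (Q (q x)) = x
    rw [hQ' _ ((hmem x).1 hx), sub_add_cancel]

end Restriction

/-! ### Stabilization, passage to larger indices, and the two equivalences -/

section Persistence

variable {𝕜 X : Type*} [RCLike 𝕜] [NormedAddCommGroup X] [NormedSpace 𝕜 X]

theorem stableSet_nonempty_of_finiteDimensional_inf {T : X →L[𝕜] X} {d : ℕ}
    [FiniteDimensional 𝕜 (T.ker ⊓ (T ^ d).range : Submodule 𝕜 X)] : (stableSet T).Nonempty := by
  let L : Submodule 𝕜 X := T.ker ⊓ (T ^ d).range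
  let f : ℕ →o (Submodule 𝕜 L)ᵒᵈ :=
    ⟨fun n => OrderDual.toDual ((T ^ n).range.comap L.subtype),
      fun _ _ h => Submodule.comap_mono (range_pow_le T h)⟩
  obtain ⟨n, hn⟩ := IsArtinian.monotone_stabilizes f
  -- Only from index `d` on is `L_m` known to lie inside `L`.
  refine ⟨max n d, fun m hm => le_antisymm (fun x hx => ⟨hx.1, ?_⟩)
    (inf_le_inf_left _ (range_pow_le T hm))⟩
  have hxL : x ∈ L := ⟨hx.1, range_pow_le T (le_max_right n d) hx.2⟩
  have h : (T ^ n).range.comap L.subtype = (T ^ m).range.comap L.subtype :=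
    hn m ((le_max_left n d).trans hm)
  have hxn : (⟨x, hxL⟩ : L) ∈ (T ^ n).range.comap L.subtype :=
    range_pow_le T (le_max_left n d) hx.2
  rw [h] at hxn
  exact hxn

theorem stableSet_nonempty_of_finiteDimensional_quotient {T : X →L[𝕜] X} {d : ℕ}
    [FiniteDimensional 𝕜 (X ⧸ (T.range ⊔ (T ^ d).ker))] : (stableSet T).Nonempty := by
  let M : ℕ → Submodule 𝕜 X := fun n => T.range ⊔ (T ^ n).ker
  have hM : Monotone M := fun _ _ h => sup_le_sup_left (ker_pow_le T h) _
  let f : ℕ →o Submodule 𝕜 (X ⧸ M d) :=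
    ⟨fun n => (M n).map (M d).mkQ, fun _ _ h => Submodule.map_mono (hM h)⟩
  have : FiniteDimensional 𝕜 (X ⧸ M d) := ‹_›
  obtain ⟨n, hn⟩ := monotone_stabilizes_iff_noetherian.2 inferInstance f
  refine ⟨max n d, (mem_stableSet_iff_sup T _).2 fun m hm => ?_⟩
  have key : ∀ k, n ≤ k → d ≤ k → M k = ((M n).map (M d).mkQ).comap (M d).mkQ := fun k hk hdk => by
    have h : (M n).map (M d).mkQ = (M k).map (M d).mkQ := hn k hk
    rw [h, Submodule.comap_map_mkQ, sup_eq_right.2 (hM hdk)]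
  exact (key _ (le_max_left n d) (le_max_right n d)).trans
    (key m ((le_max_left n d).trans hm) ((le_max_right n d).trans hm)).symm

/-- `T^n` sends `N(T^(n+1))` into `L_d` with kernel `N(T^n)`, so `M_(n+1)` is `M_n` plus a
finite-dimensional space. -/
theorem closedComplemented_range_sup_ker_of_le {T : X →L[𝕜] X} {d n : ℕ} (hdn : d ≤ n)
    (hL : FiniteDimensional 𝕜 (T.ker ⊓ (T ^ d).range : Submodule 𝕜 X))
    (hM : (T.range ⊔ (T ^ d).ker).ClosedComplemented) :
    (T.range ⊔ (T ^ n).ker).ClosedComplemented := by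
  induction n, hdn using Nat.le_induction with
  | base => exact hM
  | succ n hn ih =>
    have hle : (T ^ (n + 1)).ker.map ((T ^ n : X →L[𝕜] X) : X →ₗ[𝕜] X) ≤
        T.ker ⊓ (T ^ d).range := by
      rintro _ ⟨x, hx, rfl⟩
      exact ⟨(pow_succ_apply' T n x).symm.trans hx, range_pow_le T hn ⟨x, rfl⟩⟩
    have := Submodule.finiteDimensional_of_le hle
    obtain ⟨U, hU, hUK, hKU⟩ := exists_finiteDimensional_le_ker_sup
      ((T ^ n : X →L[𝕜] X) : X →ₗ[𝕜] X) (T ^ (n + 1)).ker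
    have h : T.range ⊔ (T ^ (n + 1)).ker = (T.range ⊔ (T ^ n).ker) ⊔ U := by
      refine le_antisymm (sup_le (le_sup_left.trans le_sup_left) (hKU.trans ?_))
        (sup_le (sup_le_sup_left (ker_pow_le T n.le_succ) _) (hUK.trans le_sup_right))
      exact sup_le_sup_right le_sup_right _
    rw [h]
    exact closedComplemented_sup_of_finiteDimensional ih U

variable [CompleteSpace X]

theorem isClosed_range_sup_ker_of_finiteDimensional_quotient {T : X →L[𝕜] X} {d : ℕ}
    (h : FiniteDimensional 𝕜 (X ⧸ (T.range ⊔ (T ^ d).ker))) :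
    IsClosed ((T.range ⊔ (T ^ d).ker : Submodule 𝕜 X) : Set X) := by
  have : CompleteSpace (T ^ d).ker := (T ^ d).isClosed_ker.completeSpace_coe
  have heq : (T.coprod (T ^ d).ker.subtypeL).range = T.range ⊔ (T ^ d).ker := by
    ext x
    rw [Submodule.mem_sup]
    constructor
    · rintro ⟨y, rfl⟩
      exact ⟨T y.1, ⟨y.1, rfl⟩, y.2, y.2.2, rfl⟩
    · rintro ⟨_, ⟨y, rfl⟩, u, hu, rfl⟩
      exact ⟨(y, ⟨u, hu⟩), rfl⟩
  rw [← heq] at h ⊢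
  exact isClosed_range_of_finiteDimensional_quotient _

/-- `R(T^n)` is closed of finite codimension in `R(T^d)`, hence so is `L_n` in `L_d`. -/
theorem closedComplemented_ker_inf_range_of_le {T : X →L[𝕜] X} {d n : ℕ} (hdn : d ≤ n)
    (hR : IsClosed ((T ^ d).range : Set X))
    (hS : FiniteDimensional 𝕜 ((T ^ d).range ⧸ (restrictRangePow T d).range))
    (hL : (T.ker ⊓ (T ^ d).range).ClosedComplemented) :
    (T.ker ⊓ (T ^ n).range).ClosedComplemented := by
  have : CompleteSpace (T ^ d).range := hR.completeSpace_coe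
  obtain ⟨k, rfl⟩ := Nat.exists_eq_add_of_le hdn
  let L : Submodule 𝕜 X := T.ker ⊓ (T ^ d).range
  let ι : L →L[𝕜] (T ^ d).range := L.subtypeL.codRestrict _ fun x => x.2.2
  have hfin : FiniteDimensional 𝕜 ((T ^ d).range ⧸ (restrictRangePow T d ^ k).range) := by
    rw [(restrictRangePow T d).toLinearMap_pow k]
    exact finiteDimensional_quotient_range_pow _ k
  have hclosed := isClosed_range_of_finiteDimensional_quotient (restrictRangePow T d ^ k)
  have heq : (T.ker ⊓ (T ^ (d + k)).range).comap L.subtype =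
      (restrictRangePow T d ^ k).range.comap (ι : L →ₗ[𝕜] (T ^ d).range) := by
    rw [range_restrictRangePow_pow]
    ext x
    exact ⟨fun hx => hx.2, fun hx => ⟨x.2.1, hx⟩⟩
  refine closedComplemented_of_comap_subtype (A := L)
    (inf_le_inf_left _ (range_pow_le T hdn)) ?_ hL
  rw [heq]
  have := finiteDimensional_quotient_comap (ι : L →ₗ[𝕜] (T ^ d).range)
    (restrictRangePow T d ^ k).range
  exact Submodule.ClosedComplemented.of_finiteDimensional_quotient
    (hclosed.preimage ι.continuous)

theorem leftBFredholm_iff (T : X →L[𝕜] X) :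
    LeftBFredholm T ↔
      ∃ d : ℕ, LeftEssentiallyInvertible (restrictRangePow T d) ∧
        IsClosed ((T ^ d).range : Set X) ∧ (T ^ d).ker.ClosedComplemented := by
  constructor
  · rintro ⟨d, hdis, hL, hM⟩
    obtain ⟨hR, hN⟩ := closedComplemented_range_pow_and_ker_pow (mem_stableSet_of_dis_eq hdis) hM
      (Submodule.ClosedComplemented.of_finiteDimensional (𝕜 := 𝕜) _)
    have hS := closedComplemented_range_restrictRangePow hR.isClosed hM
    exact ⟨d, ⟨⟨hS.isClosed, (finiteDimensional_ker_restrictRangePow_iff T d).2 hL⟩, hS⟩,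
      hR.isClosed, hN⟩
  · rintro ⟨d, ⟨⟨-, hker⟩, hS⟩, hR, hN⟩
    have hL := (finiteDimensional_ker_restrictRangePow_iff T d).1 hker
    have hM := closedComplemented_range_sup_ker_of_restrictRangePow hR hN hS
    obtain ⟨n, hn, hnT⟩ := exists_dis_eq (T := T)
      (stableSet_nonempty_of_finiteDimensional_inf (d := d))
    -- The given `d` and the degree `n` need not be comparable in a fixed order; they meet at `max d
    -- n`.
    refine ⟨n, hn, ?_, ?_⟩
    · rw [hnT _ (le_max_right d n)]
      exact Submodule.finiteDimensional_of_le
        (inf_le_inf_left _ (range_pow_le T (le_max_left d n)))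
    · rw [(mem_stableSet_iff_sup T n).1 hnT _ (le_max_right d n)]
      exact closedComplemented_range_sup_ker_of_le (le_max_left d n) hL hM

theorem rightBFredholm_iff (T : X →L[𝕜] X) :
    RightBFredholm T ↔
      ∃ d : ℕ, RightEssentiallyInvertible (restrictRangePow T d) ∧
        (T ^ d).range.ClosedComplemented := by
  constructor
  · rintro ⟨d, hdis, hclosed, hfin, hL⟩
    have hM := Submodule.ClosedComplemented.of_finiteDimensional_quotient hclosed
    obtain ⟨hR, -⟩ :=
      closedComplemented_range_pow_and_ker_pow (mem_stableSet_of_dis_eq hdis) hM hL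
    refine ⟨d, ⟨⟨(finiteDimensional_quotient_range_sup_ker_iff T d).1 hfin⟩, ?_⟩, hR⟩
    rw [ker_restrictRangePow]
    exact closedComplemented_comap_subtype inf_le_right hL
  · rintro ⟨d, ⟨⟨hS⟩, hker⟩, hR⟩
    have hfin := (finiteDimensional_quotient_range_sup_ker_iff T d).2 hS
    rw [ker_restrictRangePow] at hker
    have hL := closedComplemented_of_comap_subtype inf_le_right hker hR
    obtain ⟨n, hn, hnT⟩ := exists_dis_eq (T := T)
      (stableSet_nonempty_of_finiteDimensional_quotient (d := d))
    have hfin' : FiniteDimensional 𝕜 (X ⧸ (T.range ⊔ (T ^ n).ker)) := by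
      rw [(mem_stableSet_iff_sup T n).1 hnT _ (le_max_right d n)]
      exact Module.Finite.of_surjective _ (Submodule.factor_surjective
        (sup_le_sup_left (ker_pow_le T (le_max_left d n)) T.range))
    refine ⟨n, hn, isClosed_range_sup_ker_of_finiteDimensional_quotient hfin', hfin', ?_⟩
    rw [hnT _ (le_max_right d n)]
    exact closedComplemented_ker_inf_range_of_le (le_max_left d n) hR.isClosed hS hL

end Persistence

end BFredholm

theorem theoremC6 {𝕜 X : Type*} [RCLike 𝕜] [NormedAddCommGroup X] [NormedSpace 𝕜 X]
    [CompleteSpace X] (T : X →L[𝕜] X) :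
    (BFredholm.LeftBFredholm T ↔
      ∃ d : ℕ, BFredholm.LeftEssentiallyInvertible (BFredholm.restrictRangePow T d) ∧
        IsClosed ((T ^ d).range : Set X) ∧
        (T ^ d).ker.ClosedComplemented) ∧
    (BFredholm.RightBFredholm T ↔
      ∃ d : ℕ, BFredholm.RightEssentiallyInvertible (BFredholm.restrictRangePow T d) ∧
        (T ^ d).range.ClosedComplemented) :=
  ⟨BFredholm.leftBFredholm_iff T, BFredholm.rightBFredholm_iff T⟩
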